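/- Let $d$ be an odd prime, $n\ge 0$ an integer, and $\omega=e^{2\pi i/d}$. Let $\mathbb{C}^d$ have the orthonormal basis $\{|j\rangle : j\in\mathbb{Z}/d\mathbb{Z}\}$. Define one-qudit operators $$X|j\rangle=|j+1\rangle,\qquad Z|j\rangle=\omega^{j}|j\rangle,\qquad F|j\rangle=\tfrac{1}{\sqrt d}\sum_{m\in\mathbb{Z}/d\mathbb{Z}}\omega^{jm}|m\rangle,\qquad S|j\rangle=\omega^{j(j+1)/2}|j\rangle,$$ and the two-qudit operator $C_X|j\rangle|k\rangle=|j\rangle|j+k\rangle$. Let $\mathcal{P}_d=\langle X,Z\rangle$ be the group generated by $X$ and $Z$, let $\mathcal{P}_d^n=\{p_1\otimes\cdots\otimes p_n : p_k\in\mathcal{P}_d\}$ be the generalised Pauli group on $n$ qudits, and let $$\mathcal{C}_d^n=\{N\in U(d^n) : \forall A\in\mathcal{P}_d^n\ \exists A'\in\mathcal{P}_d^n,\ c\in\mathbb{C}\ \text{such that}\ NAN^\dagger=cA'\}$$ be the Clifford group on $n$ qudits. A circuit over $\{C_X,F,S\}$ is a finite (possibly empty) product of operators on $(\mathbb{C}^d)^{\otimes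 n}$, each of which is $F$ or $S$ acting on one qudit, or $C_X$ acting on an ordered pair (control, target) of distinct qudits, and as the identity on all other qudits. Then, up to a global phase, the Clifford group on $n$ qudits is generated by $\{C_X,F,S\}$: an operator $U$ on $(\mathbb{C}^d)^{\otimes n}$ belongs to $\mathcal{C}_d^n$ if and only if $U=cC$ for some $c\in\mathbb{C}$ with $|c|=1$ and some circuit $C$ over $\{C_X,F,S\}$. The same equivalence holds for circuits in which $C_X$ is applied only to neighbouring qudits, with control $i$ and target $i+1$. -/

import Mathlib

open scoped Matrix

noncomputable section

namespace Qudit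

/-- The primitive `d`-th root of unity `ω = exp (2πi/d)`. -/
def omega (d : ℕ) : ℂ := Complex.exp (2 * Real.pi * Complex.I / d)

/-- One-qudit operators: matrices in the computational basis `|j⟩`, `j ∈ ℤ/d`.
The entry `A a b` is `⟨a| A |b⟩`, so column `b` is the image of `|b⟩`. -/
abbrev Op1 (d : ℕ) : Type := Matrix (ZMod d) (ZMod d) ℂ

/-- Operators on `n` qudits: matrices in the computational basis
`|x₁⟩ ⊗ ⋯ ⊗ |xₙ⟩`, `x ∈ (ℤ/d)ⁿ`, of the `dⁿ`-dimensional space. -/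
abbrev Op (d n : ℕ) : Type := Matrix (Fin n → ZMod d) (Fin n → ZMod d) ℂ

/-- `X |j⟩ = |j + 1⟩`. -/
def matX (d : ℕ) : Op1 d := Matrix.of fun a j => if a = j + 1 then 1 else 0

/-- `Z |j⟩ = ω ^ j |j⟩`. -/
def matZ (d : ℕ) : Op1 d := Matrix.diagonal fun j => omega d ^ j.val

/-- The Fourier gate `F |j⟩ = (1/√d) ∑ₘ ω ^ (j m) |m⟩`. -/
def matF (d : ℕ) : Op1 d :=
  Matrix.of fun m j => ((Real.sqrt d : ℝ) : ℂ)⁻¹ * omega d ^ (j.val * m.val)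

/-- The phase gate `S |j⟩ = ω ^ (j (j + 1) / 2) |j⟩` (the natural-number division is exact). -/
def matS (d : ℕ) : Op1 d :=
  Matrix.diagonal fun j => omega d ^ (j.val * (j.val + 1) / 2)

/-- The two-qudit gate `C_X |j⟩|k⟩ = |j⟩|j + k⟩`. -/
def matCX (d : ℕ) : Matrix (ZMod d × ZMod d) (ZMod d × ZMod d) ℂ :=
  Matrix.of fun a b => if a = (b.1, b.1 + b.2) then 1 else 0

theorem star_omega_mul (d : ℕ) : star (omega d) * omega d = 1 := by
  rw [omega, Complex.star_def, ← Complex.exp_conj, ← Complex.exp_add]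
  have h : (starRingEnd ℂ) (2 * Real.pi * Complex.I / d) = -(2 * Real.pi * Complex.I / d) := by
    rw [map_div₀, map_mul, map_mul, Complex.conj_I, Complex.conj_ofReal, map_natCast,
      map_ofNat]
    ring
  rw [h, neg_add_cancel, Complex.exp_zero]

theorem matX_mem (d : ℕ) [NeZero d] : matX d ∈ Matrix.unitaryGroup (ZMod d) ℂ := by
  rw [Matrix.mem_unitaryGroup_iff']
  ext i j
  simp [matX, Matrix.mul_apply, Matrix.star_apply, Matrix.one_apply, apply_ite]
  split_ifs with h
  · exact h.symm
  · exact fun h' => h h'.symm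

theorem matZ_mem (d : ℕ) [NeZero d] : matZ d ∈ Matrix.unitaryGroup (ZMod d) ℂ := by
  rw [Matrix.mem_unitaryGroup_iff', matZ, Matrix.star_eq_conjTranspose,
    Matrix.diagonal_conjTranspose, Matrix.diagonal_mul_diagonal, ← Matrix.diagonal_one]
  congr 1
  funext j
  rw [Pi.star_apply, star_pow, ← mul_pow, star_omega_mul, one_pow]

/-- The one-qudit Pauli group: the group generated by `X` and `Z`. -/
def pauliOne (d : ℕ) [NeZero d] : Subgroup (Matrix.unitaryGroup (ZMod d) ℂ) :=
  Subgroup.closure {⟨matX d, matX_mem d⟩, ⟨matZ d, matZ_mem d⟩}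

/-- The tensor product `p₁ ⊗ ⋯ ⊗ pₙ` of one-qudit operators. -/
def tensor {d n : ℕ} (p : Fin n → Op1 d) : Op d n :=
  Matrix.of fun x y => ∏ k, p k (x k) (y k)

/-- The `n`-qudit Pauli group: all `p₁ ⊗ ⋯ ⊗ pₙ` with each `pₖ` in the one-qudit Pauli group. -/
def pauli (d n : ℕ) [NeZero d] : Set (Op d n) :=
  {A | ∃ p : Fin n → Matrix.unitaryGroup (ZMod d) ℂ,
    (∀ k, p k ∈ pauliOne d) ∧ A = tensor fun k => (p k : Op1 d)}

/-- The normaliser up to phase of a set `G` of matrices, within the unitary group. -/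
def phaseNormalizer {ι : Type*} [Fintype ι] [DecidableEq ι] (G : Set (Matrix ι ι ℂ)) :
    Set (Matrix ι ι ℂ) :=
  {N | N ∈ Matrix.unitaryGroup ι ℂ ∧ ∀ A ∈ G, ∃ A' ∈ G, ∃ c : ℂ, N * A * Nᴴ = c • A'}

/-- The `n`-qudit Clifford group. -/
def clifford (d n : ℕ) [NeZero d] : Set (Op d n) := phaseNormalizer (pauli d n)

/-- The gate `g` applied to qudit `i`, the identity on all other qudits. -/
def onQudit {d n : ℕ} (i : Fin n) (g : Op1 d) : Op d n :=
  tensor (Function.update (fun _ => 1) i g)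

/-- The two-qudit gate `g` applied to the qudits `i` (first) and `j` (second),
the identity on all other qudits; meant for `i ≠ j`. -/
def onPair {d n : ℕ} (i j : Fin n) (g : Matrix (ZMod d × ZMod d) (ZMod d × ZMod d) ℂ) :
    Op d n :=
  Matrix.of fun x y =>
    if ∀ k, k ≠ i → k ≠ j → x k = y k then g (x i, x j) (y i, y j) else 0

/-- The elementary steps of circuits over `{C_X, F, S}` on `n` qudits: `F` or `S` on any one
qudit, and `C_X` with control `i` and target `j` for any `i ≠ j` with `E i j`. -/
def gates (d n : ℕ) (E : Fin n → Fin n → Prop) : Set (Op d n) :=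
  {U | (∃ i, U = onQudit i (matF d)) ∨ (∃ i, U = onQudit i (matS d)) ∨
    ∃ i j, i ≠ j ∧ E i j ∧ U = onPair i j (matCX d)}

/-- The operators computed by circuits: finite (possibly empty) products of gates,
without inverses. -/
def circuits (d n : ℕ) [NeZero d] (E : Fin n → Fin n → Prop) : Submonoid (Op d n) :=
  Submonoid.closure (gates d n E)

/-- The operators that agree, up to a global phase, with an operator computed by a circuit. -/
def circuitsUpToPhase (d n : ℕ) [NeZero d] (E : Fin n → Fin n → Prop) : Set (Op d n) :=
  {U | ∃ c : ℂ, ‖c‖ = 1 ∧ ∃ C ∈ circuits d n E, U = c • C}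

end Qudit

end

/-!
An operator of the Clifford group permutes the Weyl operators `X ^ a Z ^ b` up to scalars, and so
acts on the phase space `(ℤ/d)ⁿ × (ℤ/d)ⁿ` by a symplectic automorphism. Two operators with the same
action differ by a scalar and a Weyl operator, and Weyl operators are products of `F` and `S`, so
it is enough that the actions of the gates generate the symplectic group.

The gate `S` on qudit `i` acts by the transvection in the direction `zᵢ`, and conjugating by `F` and
`C_X` yields the directions `xᵢ` and `xᵢ + xⱼ`. The directions all of whose transvections belong to
a given group are closed under scaling and under sums of nonorthogonal vectors. When the graph of
coupled qudits is connected, the vectors found so far are joined by chains of nonorthogonal ones,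
and this closure reaches all of phase space as soon as the field has three elements. Finally,
transvections generate the symplectic group: one or two of them, multiplied with a nontrivial
isometry, enlarge its fixed space.
-/

namespace SymplecticSpace

section Transvections

variable {K V : Type*} [CommRing K] [AddCommGroup V] [Module K V] {B : LinearMap.BilinForm K V}

/-- The group of linear automorphisms preserving the bilinear form `B`. -/
def isometryGroup (B : LinearMap.BilinForm K V) : Subgroup (V ≃ₗ[K] V) where
  carrier := {σ | ∀ v w, B (σ v) (σ w) = B v w}
  one_mem' _ _ := rfl
  mul_mem' hσ hτ v w := (hσ _ _).trans (hτ v w)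
  inv_mem' {σ} hσ v w := by
    rw [← hσ (σ⁻¹ v), ← LinearEquiv.mul_apply, ← LinearEquiv.mul_apply, mul_inv_cancel]
    rfl

/-- The transvection `x ↦ x + t • B u x • u` in the direction `u`. -/
def transvection (hB : B.IsAlt) (u : V) (t : K) : V ≃ₗ[K] V :=
  LinearEquiv.transvection (f := t • B u) (v := u) (by simp [hB.self_eq_zero u])

theorem transvection_apply (hB : B.IsAlt) (u : V) (t : K) (x : V) :
    transvection hB u t x = x + (t * B u x) • u :=
  rfl

theorem transvection_apply_eq_self (hB : B.IsAlt) {u x : V} (h : B u x = 0) (t : K) :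
    transvection hB u t x = x := by
  rw [transvection_apply, h, mul_zero, zero_smul, add_zero]

theorem transvection_mem_isometryGroup (hB : B.IsAlt) (u : V) (t : K) :
    transvection hB u t ∈ isometryGroup B := by
  intro v w
  have h : B v u = -B u v := (hB.neg_eq u v).symm
  simp only [transvection_apply, map_add, map_smul, LinearMap.add_apply, LinearMap.smul_apply,
    hB.self_eq_zero u, h, smul_eq_mul]
  ring

theorem transvection_smul (hB : B.IsAlt) (c : K) (u : V) (t : K) :
    transvection hB (c • u) t = transvection hB u (c * c * t) := by
  ext x
  simp only [transvection_apply, map_smul, LinearMap.smul_apply, smul_eq_mul, smul_smul]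
  ring_nf

theorem transvection_add (hB : B.IsAlt) (u : V) (s t : K) :
    transvection hB u (s + t) = transvection hB u s * transvection hB u t := by
  ext x
  have hux : B u (x + (t * B u x) • u) = B u x := by
    rw [map_add, map_smul, hB.self_eq_zero u, smul_zero, add_zero]
  rw [LinearEquiv.mul_apply, transvection_apply, transvection_apply, transvection_apply, hux]
  module

theorem transvection_nsmul (hB : B.IsAlt) (u : V) (k : ℕ) (t : K) :
    transvection hB u (k • t) = transvection hB u t ^ k := by
  induction k with
  | zero => ext x; simp [transvection_apply]
  | succ k ih => rw [succ_nsmul, pow_succ, transvection_add, ih]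

theorem transvection_map (hB : B.IsAlt) {σ : V ≃ₗ[K] V} (hσ : σ ∈ isometryGroup B) (u : V)
    (t : K) : transvection hB (σ u) t = σ * transvection hB u t * σ⁻¹ := by
  ext x
  obtain ⟨y, rfl⟩ := σ.surjective x
  have h : σ⁻¹ (σ y) = y := σ.symm_apply_apply y
  simp only [LinearEquiv.mul_apply, transvection_apply, h, map_add, map_smul, hσ u y]

/-- The directions `u` all of whose transvections belong to the group `R`. -/
def transvectionDirections (hB : B.IsAlt) (R : Subgroup (V ≃ₗ[K] V)) : Set V :=
  {u | ∀ t, transvection hB u t ∈ R}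

theorem map_mem_transvectionDirections {hB : B.IsAlt} {R : Subgroup (V ≃ₗ[K] V)}
    {σ : V ≃ₗ[K] V} (hσR : σ ∈ R) (hσ : σ ∈ isometryGroup B) {u : V}
    (hu : u ∈ transvectionDirections hB R) : σ u ∈ transvectionDirections hB R := fun t => by
  rw [transvection_map hB hσ]
  exact R.mul_mem (R.mul_mem hσR (hu t)) (R.inv_mem hσR)

/-- A set of vectors closed under scaling and under addition of nonorthogonal vectors. -/
structure HyperbolicClosed (B : LinearMap.BilinForm K V) (T : Set V) : Prop where
  smul_mem : ∀ (c : K) {u : V}, u ∈ T → c • u ∈ T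
  add_mem : ∀ {u v : V}, u ∈ T → v ∈ T → B u v ≠ 0 → u + v ∈ T

theorem ne_zero_comm (hB : B.IsAlt) {u v : V} (h : B u v ≠ 0) : B v u ≠ 0 := by
  rwa [← hB.neg_eq, neg_ne_zero]

theorem exists_mem_ne_zero_of_span_eq_top (hsep : B.SeparatingLeft) {S : Set V}
    (hS : Submodule.span K S = ⊤) {v : V} (hv : v ≠ 0) : ∃ s ∈ S, B v s ≠ 0 := by
  contrapose! hv
  have h : B v = 0 := LinearMap.ext_on hS fun s hs => hv s hs
  exact hsep v fun w => by rw [h, LinearMap.zero_apply]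

/-- Any two members of `S` are joined by a path in `T` whose successive vectors are
nonorthogonal. -/
def NonorthogonallyConnected (B : LinearMap.BilinForm K V) (S T : Set V) : Prop :=
  ∀ s ∈ S, ∀ s' ∈ S, Relation.ReflTransGen (fun u v => u ∈ T ∧ v ∈ T ∧ B u v ≠ 0) s s'

theorem pairing_sub_eq_zero_of_fixed {σ : V ≃ₗ[K] V} (hσ : σ ∈ isometryGroup B) {x : V} (v : V)
    (hx : σ x = x) : B (σ v - v) x = 0 := by
  have h : B (σ v) x = B v x := by
    rw [← hσ v x, hx]
  rw [map_sub, LinearMap.sub_apply, h, sub_self]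

namespace HyperbolicClosed

variable {S T : Set V}

theorem exists_link_of_chain (hT : HyperbolicClosed B T) {a b c e : V} (hb : b ∈ T) (hc : c ∈ T)
    (hab : B a b ≠ 0) (hbc : B b c ≠ 0) (hce : B c e ≠ 0) :
    ∃ w ∈ T, B a w ≠ 0 ∧ B w e ≠ 0 := by
  by_cases hac : B a c = 0
  · by_cases hbe : B b e = 0
    · refine ⟨b + c, hT.add_mem hb hc hbc, ?_, ?_⟩
      · rwa [map_add, hac, add_zero]
      · rwa [map_add, LinearMap.add_apply, hbe, zero_add]
    · exact ⟨b, hb, hab, hbe⟩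
  · exact ⟨c, hc, hac, hce⟩

theorem exists_link (hT : HyperbolicClosed B T) (hB : B.IsAlt) (hsep : B.SeparatingLeft)
    (hspan : Submodule.span K S = ⊤) (hST : S ⊆ T) (hconn : NonorthogonallyConnected B S T)
    {u v : V} (huT : u ∈ T) (hu : u ≠ 0) (hv : v ≠ 0) : ∃ w ∈ T, B u w ≠ 0 ∧ B w v ≠ 0 := by
  obtain ⟨s, hs, hus⟩ := exists_mem_ne_zero_of_span_eq_top hsep hspan hu
  obtain ⟨s', hs', hvs'⟩ := exists_mem_ne_zero_of_span_eq_top hsep hspan hv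
  have hlink : ∀ p, Relation.ReflTransGen (fun u v => u ∈ T ∧ v ∈ T ∧ B u v ≠ 0) s p →
      ∃ w ∈ T, B u w ≠ 0 ∧ B w p ≠ 0 := by
    intro p hp
    induction hp with
    | refl => exact hT.exists_link_of_chain (hST hs) huT hus (ne_zero_comm hB hus) hus
    | tail _ hpq ih =>
      obtain ⟨w, hw, huw, hwp⟩ := ih
      exact hT.exists_link_of_chain hw hpq.1 huw hwp hpq.2.2
  obtain ⟨w, hw, huw, hws'⟩ := hlink s' (hconn s hs s' hs')
  exact hT.exists_link_of_chain hw (hST hs') huw hws' (ne_zero_comm hB hvs')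

end HyperbolicClosed

end Transvections

section Field

variable {K V : Type*} [Field K] [AddCommGroup V] [Module K V] {B : LinearMap.BilinForm K V}

theorem hyperbolicClosed_transvectionDirections (hB : B.IsAlt) (R : Subgroup (V ≃ₗ[K] V)) :
    HyperbolicClosed B (transvectionDirections hB R) where
  smul_mem c u hu t := by
    rw [transvection_smul]
    exact hu _
  add_mem {u v} hu hv huv := by
    have hmap : transvection hB u (B u v)⁻¹ v = u + v := by
      rw [transvection_apply, inv_mul_cancel₀ huv, one_smul, add_comm]
    rw [← hmap]
    exact map_mem_transvectionDirections (hu _) (transvection_mem_isometryGroup hB _ _) hv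

namespace HyperbolicClosed

variable {S T : Set V}

theorem exists_common_link (hT : HyperbolicClosed B T) (hB : B.IsAlt) (hsep : B.SeparatingLeft)
    (hK : 3 ≤ Cardinal.mk K) (hspan : Submodule.span K S = ⊤) (hST : S ⊆ T)
    (hconn : NonorthogonallyConnected B S T) {u v : V} (huT : u ∈ T) (hu : u ≠ 0) (hv : v ≠ 0)
    (huv : u + v ≠ 0) : ∃ t ∈ T, B t u ≠ 0 ∧ B t v ≠ 0 ∧ B t (u + v) ≠ 0 := by
  obtain ⟨w, hwT, huw, hwv⟩ := hT.exists_link hB hsep hspan hST hconn huT hu hv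
  have hwu : B w u ≠ 0 := ne_zero_comm hB huw
  by_cases hwuv : B w (u + v) = 0
  swap
  · exact ⟨w, hwT, hwu, hwv, hwuv⟩
  have hw : w ≠ 0 := by
    rintro rfl
    exact hwu (by rw [map_zero, LinearMap.zero_apply])
  obtain ⟨t, htT, hwt, htuv⟩ := hT.exists_link hB hsep hspan hST hconn hwT hw huv
  -- On the line `t + K w` the pairing with `u + v` is constant, and at most two points of it are
  -- orthogonal to `u` or to `v`.
  obtain ⟨c, hcu, hcv⟩ := Cardinal.exists_ne_ne_of_three_le hK (-B t u / B w u) (-B t v / B w v)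
  have hmem : t + c • w ∈ T := by
    by_cases hc : c = 0
    · rwa [hc, zero_smul, add_zero]
    · refine hT.add_mem htT (hT.smul_mem c hwT) ?_
      rw [map_smul]
      exact smul_ne_zero hc (ne_zero_comm hB hwt)
  have hpair (x : V) : B (t + c • w) x = B t x + c * B w x := by
    rw [map_add, map_smul, LinearMap.add_apply, LinearMap.smul_apply, smul_eq_mul]
  refine ⟨t + c • w, hmem, ?_, ?_, ?_⟩
  · rw [hpair]
    exact fun h => hcu (eq_div_of_mul_eq hwu (eq_neg_of_add_eq_zero_right h))
  · rw [hpair]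
    exact fun h => hcv (eq_div_of_mul_eq hwv (eq_neg_of_add_eq_zero_right h))
  · rwa [hpair, hwuv, mul_zero, add_zero]

theorem add_mem_of_connected (hT : HyperbolicClosed B T) (hB : B.IsAlt)
    (hsep : B.SeparatingLeft) (hK : 3 ≤ Cardinal.mk K) (hspan : Submodule.span K S = ⊤)
    (hST : S ⊆ T) (hconn : NonorthogonallyConnected B S T) {u v : V} (hu : u ∈ T)
    (hv : v ∈ T) : u + v ∈ T := by
  by_cases huv : B u v = 0
  swap
  · exact hT.add_mem hu hv huv
  obtain rfl | hu0 := eq_or_ne u 0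
  · rwa [zero_add]
  obtain rfl | hv0 := eq_or_ne v 0
  · rwa [add_zero]
  obtain huv0 | huv0 := eq_or_ne (u + v) 0
  · rw [huv0, ← zero_smul K u]
    exact hT.smul_mem 0 hu
  -- The detour through `u + t` only adds nonorthogonal vectors.
  obtain ⟨t, ht, htu, htv, htuv⟩ :=
    hT.exists_common_link hB hsep hK hspan hST hconn hu hu0 hv0 huv0
  have hut : u + t ∈ T := hT.add_mem hu ht (ne_zero_comm hB htu)
  have hutv : u + t + v ∈ T := by
    refine hT.add_mem hut hv ?_
    rwa [map_add, LinearMap.add_apply, huv, zero_add]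
  have hsum : u + v = u + t + v + (-1 : K) • t := by module
  rw [hsum]
  refine hT.add_mem hutv (hT.smul_mem _ ht) ?_
  have hpair : B (u + t + v) t = B (u + v) t := by
    rw [add_right_comm, map_add, LinearMap.add_apply, hB.self_eq_zero t, add_zero]
  rw [map_smul, hpair]
  exact smul_ne_zero (neg_ne_zero.mpr one_ne_zero) (ne_zero_comm hB htuv)

theorem eq_univ_of_connected (hT : HyperbolicClosed B T) (hB : B.IsAlt)
    (hsep : B.SeparatingLeft) (hK : 3 ≤ Cardinal.mk K) (hspan : Submodule.span K S = ⊤)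
    (hST : S ⊆ T) (hconn : NonorthogonallyConnected B S T) (hT0 : 0 ∈ T) : T = Set.univ := by
  refine Set.eq_univ_of_forall fun v => ?_
  have hv : v ∈ Submodule.span K S := hspan ▸ Submodule.mem_top
  induction hv using Submodule.span_induction with
  | mem s hs => exact hST hs
  | zero => exact hT0
  | add u v _ _ hu hv => exact hT.add_mem_of_connected hB hsep hK hspan hST hconn hu hv
  | smul c u _ hu => exact hT.smul_mem c hu

end HyperbolicClosed

end Field

section CartanDieudonne

variable {K V : Type*} [Field K] [AddCommGroup V] [Module K V] {B : LinearMap.BilinForm K V}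

theorem exists_transvection_fixed_lt (hB : B.IsAlt) {σ : V ≃ₗ[K] V} (hσ : σ ∈ isometryGroup B)
    {v : V} (hv : B v (σ v) ≠ 0) : ∃ u t, LinearMap.fixedSubmodule (σ : V →ₗ[K] V) <
      LinearMap.fixedSubmodule (transvection hB u t * σ : V ≃ₗ[K] V).toLinearMap := by
  set u := σ v - v with hu
  have huv : B u (σ v) = -B v (σ v) := by
    rw [hu, map_sub, LinearMap.sub_apply, hB.self_eq_zero, zero_sub]
  refine ⟨u, (B v (σ v))⁻¹, SetLike.lt_iff_le_and_exists.mpr ⟨fun x hx => ?_, v, ?_, ?_⟩⟩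
  · have hx : σ x = x := hx
    change transvection hB u _ (σ x) = x
    rw [hx, transvection_apply_eq_self hB (pairing_sub_eq_zero_of_fixed hσ v hx)]
  · change transvection hB u _ (σ v) = v
    rw [transvection_apply, huv, mul_neg, inv_mul_cancel₀ hv, neg_one_smul, hu]
    abel
  · intro hfix
    have hfix : σ v = v := hfix
    exact hv (by rw [hfix, hB.self_eq_zero])

theorem exists_transvection_nonorthogonal (hB : B.IsAlt) (hsep : B.SeparatingLeft)
    {σ : V ≃ₗ[K] V} (hσ : σ ∈ isometryGroup B) (hσ1 : σ ≠ 1) (hself : ∀ v, B v (σ v) = 0) :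
    ∃ u v, LinearMap.fixedSubmodule (σ : V →ₗ[K] V) ≤
      LinearMap.fixedSubmodule (transvection hB u 1 * σ : V ≃ₗ[K] V).toLinearMap ∧
      B v ((transvection hB u 1 * σ) v) ≠ 0 := by
  obtain ⟨w, hw⟩ : ∃ w, σ w ≠ w := by
    contrapose! hσ1
    exact LinearEquiv.ext hσ1
  set u := σ w - w with hu
  obtain ⟨x, hx⟩ : ∃ x, B u x ≠ 0 := by
    by_contra! h
    exact hw (sub_eq_zero.mp (hsep u h))
  have hux : B u (σ x) = -B u x := by
    have hpolar : B x (σ w) + B w (σ x) = 0 := by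
      have h := hself (x + w)
      simpa only [map_add, LinearMap.add_apply, hself, zero_add, add_zero, add_comm] using h
    have hσwx := hσ w x
    have hswap := hB.neg_eq x (σ w)
    simp only [hu, map_sub, LinearMap.sub_apply]
    linear_combination hσwx - hpolar - hswap
  refine ⟨u, x, fun y hy => ?_, ?_⟩
  · have hy : σ y = y := hy
    change transvection hB u 1 (σ y) = y
    rw [hy, transvection_apply_eq_self hB (pairing_sub_eq_zero_of_fixed hσ w hy)]
  · rw [LinearEquiv.mul_apply, transvection_apply, one_mul, hux, map_add, hself, zero_add, map_smul,
      smul_eq_mul]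
    exact mul_ne_zero (neg_ne_zero.mpr hx) (ne_zero_comm hB hx)

theorem isometryGroup_le_of_transvectionDirections_eq_univ [FiniteDimensional K V]
    (hB : B.IsAlt) (hsep : B.SeparatingLeft) {R : Subgroup (V ≃ₗ[K] V)}
    (hR : transvectionDirections hB R = Set.univ) : isometryGroup B ≤ R := by
  have hmem (u : V) (t : K) : transvection hB u t ∈ R := by
    have hu : u ∈ transvectionDirections hB R := hR ▸ Set.mem_univ u
    exact hu t
  intro σ hσ
  induction h : LinearMap.fixedSubmodule (σ : V →ₗ[K] V) using WellFoundedGT.induction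
    generalizing σ with
  | ind W ih =>
    subst h
    by_cases hσ1 : σ = 1
    · rw [hσ1]
      exact R.one_mem
    have hmul {u : V} {t : K} {τ : V ≃ₗ[K] V} (hτ : τ ∈ isometryGroup B) :
        transvection hB u t * τ ∈ isometryGroup B :=
      (isometryGroup B).mul_mem (transvection_mem_isometryGroup hB u t) hτ
    by_cases hself : ∀ v, B v (σ v) = 0
    · obtain ⟨u, v, hle, hv⟩ := exists_transvection_nonorthogonal hB hsep hσ hσ1 hself
      obtain ⟨u', t, hlt⟩ := exists_transvection_fixed_lt hB (hmul hσ) hv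
      have := ih _ (hle.trans_lt hlt) (hmul (hmul hσ)) rfl
      rwa [R.mul_mem_cancel_left (hmem _ _), R.mul_mem_cancel_left (hmem _ _)] at this
    · push Not at hself
      obtain ⟨v, hv⟩ := hself
      obtain ⟨u, t, hlt⟩ := exists_transvection_fixed_lt hB hσ hv
      have := ih _ hlt (hmul hσ) rfl
      rwa [R.mul_mem_cancel_left (hmem _ _)] at this

theorem isometryGroup_le_of_nonorthogonallyConnected [FiniteDimensional K V] (hB : B.IsAlt)
    (hsep : B.SeparatingLeft) (hK : 3 ≤ Cardinal.mk K) {R : Subgroup (V ≃ₗ[K] V)} {S : Set V}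
    (hspan : Submodule.span K S = ⊤) (hS : S ⊆ transvectionDirections hB R)
    (hconn : NonorthogonallyConnected B S (transvectionDirections hB R)) :
    isometryGroup B ≤ R := by
  refine isometryGroup_le_of_transvectionDirections_eq_univ hB hsep ?_
  refine (hyperbolicClosed_transvectionDirections hB R).eq_univ_of_connected hB hsep hK hspan hS
    hconn fun t => ?_
  rw [show transvection hB 0 t = 1 from LinearEquiv.ext fun x => by simp [transvection_apply]]
  exact R.one_mem

end CartanDieudonne

end SymplecticSpace
namespace Qudit

open ZMod (stdAddChar)
open SymplecticSpace

section Characters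

theorem stdAddChar_ne_zero {d : ℕ} [NeZero d] (a : ZMod d) : stdAddChar a ≠ 0 :=
  (AddChar.val_isUnit stdAddChar a).ne_zero

theorem star_stdAddChar {d : ℕ} [NeZero d] (a : ZMod d) :
    star (stdAddChar a) = stdAddChar (-a) :=
  (AddChar.map_neg_eq_conj _ _).symm

theorem stdAddChar_sum {d : ℕ} [NeZero d] {ι : Type*} (s : Finset ι) (f : ι → ZMod d) :
    stdAddChar (∑ i ∈ s, f i) = ∏ i ∈ s, stdAddChar (f i) :=
  map_prod (AddChar.toMonoidHom stdAddChar) (fun i => Multiplicative.ofAdd (f i)) s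

theorem omega_pow {d : ℕ} [NeZero d] (k : ℕ) : omega d ^ k = stdAddChar (k : ZMod d) := by
  have h := ZMod.stdAddChar_coe (N := d) (k : ℤ)
  push_cast at h
  rw [h, omega, ← Complex.exp_nat_mul]
  congr 1
  ring

theorem exists_addChar_eq_stdAddChar_pairing {d : ℕ} [NeZero d] {M : Type*} [AddCommGroup M]
    [Module (ZMod d) M] [Finite M] {B : LinearMap.BilinForm (ZMod d) M} (hB : B.SeparatingLeft)
    (ψ : AddChar M ℂ) : ∃ u, ∀ v, ψ v = stdAddChar (B u v) := by
  have := Fintype.ofFinite M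
  let Φ : M → AddChar M ℂ := fun u => stdAddChar.compAddMonoidHom (B u).toAddMonoidHom
  have hinj : Function.Injective Φ := fun u u' h => by
    rw [← sub_eq_zero]
    refine hB _ fun v => ?_
    rw [map_sub, LinearMap.sub_apply, sub_eq_zero]
    exact ZMod.injective_stdAddChar (DFunLike.congr_fun h v)
  obtain ⟨u, hu⟩ :=
    ((Fintype.bijective_iff_injective_and_card Φ).2 ⟨hinj, AddChar.card_eq.symm⟩).surjective ψ
  exact ⟨u, fun v => (DFunLike.congr_fun hu v).symm⟩

end Characters

section Tensor

variable {d n : ℕ} [NeZero d]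

/-- The tensor product of operators, as a monoid homomorphism. -/
def tensorHom : (Fin n → Op1 d) →* Op d n where
  toFun := tensor
  map_one' := by
    ext x y
    simp only [tensor, Matrix.of_apply, Pi.one_apply, Matrix.one_apply, Finset.prod_ite_zero,
      Finset.prod_const_one, Finset.mem_univ, true_implies, funext_iff]
  map_mul' p q := by
    ext x y
    simp only [tensor, Matrix.mul_apply, Matrix.of_apply, Pi.mul_apply, ← Finset.prod_mul_distrib]
    exact Fintype.prod_sum fun k z => p k (x k) z * q k z (y k)

theorem tensorHom_apply (p : Fin n → Op1 d) : tensorHom p = tensor p :=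
  rfl

theorem onQudit_eq_tensorHom (i : Fin n) (g : Op1 d) :
    onQudit i g = tensorHom (Pi.mulSingle i g) :=
  rfl

theorem star_tensor {d n : ℕ} (p : Fin n → Op1 d) : star (tensor p) = tensor (star p) := by
  ext x y
  simp [tensor, Matrix.star_apply]

theorem tensor_smul {d n : ℕ} (c : Fin n → ℂ) (p : Fin n → Op1 d) :
    tensor (fun k => c k • p k) = (∏ k, c k) • tensor p := by
  ext x y
  simp [tensor, Finset.prod_mul_distrib]

theorem tensor_mem_unitaryGroup {p : Fin n → Op1 d}
    (hp : ∀ k, p k ∈ Matrix.unitaryGroup (ZMod d) ℂ) :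
    tensor p ∈ Matrix.unitaryGroup (Fin n → ZMod d) ℂ := by
  have h : p * star p = 1 := funext fun k => Matrix.mem_unitaryGroup_iff.1 (hp k)
  rw [Matrix.mem_unitaryGroup_iff, star_tensor, ← tensorHom_apply, ← tensorHom_apply, ← map_mul,
    h, map_one]

theorem onQudit_mem_unitaryGroup (i : Fin n) {g : Op1 d}
    (hg : g ∈ Matrix.unitaryGroup (ZMod d) ℂ) :
    onQudit i g ∈ Matrix.unitaryGroup (Fin n → ZMod d) ℂ :=
  tensor_mem_unitaryGroup <|
    (Function.forall_update_iff _ fun _ A => A ∈ Matrix.unitaryGroup (ZMod d) ℂ).2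
      ⟨hg, fun _ _ => one_mem _⟩

end Tensor

section Phase

variable {d n : ℕ}

/-- The phase space `(ℤ/d)ⁿ × (ℤ/d)ⁿ`, whose elements `(a, b)` are the exponents of the Weyl
operators `X ^ a Z ^ b`. -/
abbrev Phase (d n : ℕ) : Type := (Fin n → ZMod d) × (Fin n → ZMod d)

/-- The symplectic form on phase space. The sign is the one for which
`W v * W w = ω ^ symp v w • W w * W v` holds for the Weyl operators. -/
noncomputable def symp : LinearMap.BilinForm (ZMod d) (Phase d n) :=
  (dotProductBilin (ZMod d) (ZMod d)).compl₁₂ (LinearMap.snd _ _ _) (LinearMap.fst _ _ _) -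
    (dotProductBilin (ZMod d) (ZMod d)).compl₁₂ (LinearMap.fst _ _ _) (LinearMap.snd _ _ _)

theorem symp_apply (v w : Phase d n) : symp v w = v.2 ⬝ᵥ w.1 - v.1 ⬝ᵥ w.2 :=
  rfl

theorem symp_isAlt : (symp : LinearMap.BilinForm (ZMod d) (Phase d n)).IsAlt := fun v => by
  rw [symp_apply, dotProduct_comm, sub_self]

/-- The exponent of the operator `X` on qudit `i`. -/
def xVec (i : Fin n) : Phase d n := (Pi.single i 1, 0)

/-- The exponent of the operator `Z` on qudit `i`. -/
def zVec (i : Fin n) : Phase d n := (0, Pi.single i 1)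

theorem symp_xVec (v : Phase d n) (i : Fin n) : symp v (xVec i) = v.2 i := by
  simp [symp_apply, xVec]

theorem symp_zVec (v : Phase d n) (i : Fin n) : symp v (zVec i) = -v.1 i := by
  simp [symp_apply, zVec]

theorem symp_separatingLeft :
    (symp : LinearMap.BilinForm (ZMod d) (Phase d n)).SeparatingLeft := fun v hv => by
  refine Prod.ext (funext fun i => ?_) (funext fun i => ?_)
  · exact neg_eq_zero.1 ((symp_zVec v i).symm.trans (hv _))
  · exact (symp_xVec v i).symm.trans (hv _)

theorem span_range_xVec_union_range_zVec : Submodule.span (ZMod d)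
    (Set.range xVec ∪ Set.range zVec : Set (Phase d n)) = ⊤ := by
  refine eq_top_iff.2 fun v _ => ?_
  have hv : v = ∑ i, (v.1 i • xVec i + v.2 i • zVec i) := by
    ext k <;> simp [Prod.fst_sum, Prod.snd_sum, xVec, zVec, Pi.single_apply]
  rw [hv]
  refine Submodule.sum_mem _ fun i _ => Submodule.add_mem _ ?_ ?_
  · exact Submodule.smul_mem _ _ (Submodule.subset_span (Or.inl ⟨i, rfl⟩))
  · exact Submodule.smul_mem _ _ (Submodule.subset_span (Or.inr ⟨i, rfl⟩))

end Phase

section Weyl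

variable {d n : ℕ} [NeZero d]

/-- The one-qudit Weyl operator `X ^ a Z ^ b`. -/
noncomputable def weylOne (a b : ZMod d) : Op1 d :=
  Matrix.of fun x y => if x = y + a then stdAddChar (b * y) else 0

/-- The `n`-qudit Weyl operator `X ^ v.1 Z ^ v.2`, a tensor product of one-qudit ones. -/
noncomputable def weyl (v : Phase d n) : Op d n :=
  tensor fun k => weylOne (v.1 k) (v.2 k)

theorem weylOne_mul (a b a' b' : ZMod d) :
    weylOne a b * weylOne a' b' = stdAddChar (b * a') • weylOne (a + a') (b + b') := by
  ext x y
  simp only [weylOne, Matrix.mul_apply, Matrix.of_apply, Matrix.smul_apply, mul_ite, mul_zero,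
    Finset.sum_ite_eq', Finset.mem_univ, if_true, smul_eq_mul, add_assoc, add_comm a' a]
  split_ifs
  · simp only [← AddChar.map_add_eq_mul]
    ring_nf
  · rw [zero_mul]

theorem weylOne_zero : weylOne (0 : ZMod d) 0 = 1 := by
  ext x y
  simp [weylOne, Matrix.one_apply]

theorem star_weylOne (a b : ZMod d) :
    star (weylOne a b) = stdAddChar (a * b) • weylOne (-a) (-b) := by
  ext x y
  have h : y = x + a ↔ x = y + -a := by rw [← sub_eq_add_neg, eq_sub_iff_add_eq, eq_comm]
  simp only [Matrix.star_apply, weylOne, Matrix.of_apply, Matrix.smul_apply, h, smul_eq_mul]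
  split_ifs with hx
  · rw [star_stdAddChar, ← AddChar.map_add_eq_mul, hx]
    ring_nf
  · simp

theorem weylOne_mem_unitaryGroup (a b : ZMod d) :
    weylOne a b ∈ Matrix.unitaryGroup (ZMod d) ℂ := by
  rw [Matrix.mem_unitaryGroup_iff, star_weylOne, mul_smul_comm, weylOne_mul, smul_smul,
    ← AddChar.map_add_eq_mul]
  simp [weylOne_zero, mul_comm a b]

theorem weylOne_zero_left (b : ZMod d) :
    weylOne 0 b = Matrix.diagonal fun j => stdAddChar (b * j) := by
  ext x y
  by_cases h : x = y <;> simp [weylOne, h]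

theorem weylOne_zero_left_pow (b : ZMod d) (k : ℕ) :
    weylOne 0 b ^ k = weylOne 0 ((k : ZMod d) * b) := by
  induction k with
  | zero => simp [weylOne_zero]
  | succ k ih => rw [pow_succ, ih, weylOne_mul]; simp [add_mul]

theorem weylOne_zero_right_pow (a : ZMod d) (k : ℕ) :
    weylOne a 0 ^ k = weylOne ((k : ZMod d) * a) 0 := by
  induction k with
  | zero => simp [weylOne_zero]
  | succ k ih => rw [pow_succ, ih, weylOne_mul]; simp [add_mul]

theorem weyl_apply (v : Phase d n) (x y : Fin n → ZMod d) :
    weyl v x y = if x = y + v.1 then stdAddChar (v.2 ⬝ᵥ y) else 0 := by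
  simp only [weyl, tensor, weylOne, Matrix.of_apply, Finset.prod_ite_zero, Finset.mem_univ,
    true_implies, dotProduct, stdAddChar_sum, funext_iff, Pi.add_apply]

theorem weyl_mul (v w : Phase d n) :
    weyl v * weyl w = stdAddChar (v.2 ⬝ᵥ w.1) • weyl (v + w) := by
  simp only [weyl, ← tensorHom_apply, ← map_mul]
  simp only [tensorHom_apply, Pi.mul_def, weylOne_mul, tensor_smul, dotProduct, stdAddChar_sum,
    Prod.fst_add, Prod.snd_add, Pi.add_apply]

theorem weyl_zero : weyl (0 : Phase d n) = 1 := by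
  simp only [weyl, Prod.fst_zero, Prod.snd_zero, Pi.zero_apply, weylOne_zero]
  exact map_one tensorHom

theorem weyl_add (v w : Phase d n) :
    weyl (v + w) = (stdAddChar (v.2 ⬝ᵥ w.1))⁻¹ • (weyl v * weyl w) := by
  rw [weyl_mul, inv_smul_smul₀ (stdAddChar_ne_zero _)]

theorem weyl_mul_comm (v w : Phase d n) :
    weyl v * weyl w = stdAddChar (symp v w) • (weyl w * weyl v) := by
  rw [weyl_mul, weyl_mul, smul_smul, ← AddChar.map_add_eq_mul, add_comm w v, symp_apply,
    dotProduct_comm w.2, sub_add_cancel]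

theorem weyl_mem_unitaryGroup (v : Phase d n) :
    weyl v ∈ Matrix.unitaryGroup (Fin n → ZMod d) ℂ :=
  tensor_mem_unitaryGroup fun _ => weylOne_mem_unitaryGroup _ _

theorem isUnit_weyl (v : Phase d n) : IsUnit (weyl v) :=
  Unitary.isUnit_coe (U := ⟨weyl v, weyl_mem_unitaryGroup v⟩)

theorem eq_of_weyl_eq_smul {v w : Phase d n} {c : ℂ} (h : weyl v = c • weyl w) :
    v = w := by
  refine sub_eq_zero.1 (symp_separatingLeft _ fun x => ?_)
  have hx : stdAddChar (symp v x) • (weyl x * weyl v) =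
      stdAddChar (symp w x) • (weyl x * weyl v) := by
    rw [← weyl_mul_comm, h, smul_mul_assoc, mul_smul_comm, weyl_mul_comm w x, smul_comm]
  have hne : weyl x * weyl v ≠ 0 := ((isUnit_weyl x).mul (isUnit_weyl v)).ne_zero
  rw [map_sub, LinearMap.sub_apply, sub_eq_zero]
  exact ZMod.injective_stdAddChar (smul_left_injective ℂ hne hx)

theorem eq_smul_one_of_commute_weyl {U : Op d n} (hU : ∀ v, Commute U (weyl v)) :
    ∃ c : ℂ, U = c • 1 := by
  have hshift (a y : Fin n → ZMod d) : U (y + a) (y + a) = U y y := by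
    have h := congrFun (congrFun (hU (a, 0)) (y + a)) y
    simpa [Matrix.mul_apply, weyl_apply] using h
  have hclock (b x y : Fin n → ZMod d) :
      U x y * stdAddChar (b ⬝ᵥ y) = stdAddChar (b ⬝ᵥ x) * U x y := by
    have h := congrFun (congrFun (hU (0, b)) x) y
    simpa [Matrix.mul_apply, weyl_apply] using h
  have hoff {x y : Fin n → ZMod d} (hxy : x ≠ y) : U x y = 0 := by
    by_contra hne
    refine hxy (funext fun k => ?_)
    have h := hclock (Pi.single k 1) x y
    rw [mul_comm, mul_left_inj' hne] at h
    simpa using ZMod.injective_stdAddChar h.symm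
  refine ⟨U 0 0, Matrix.ext fun x y => ?_⟩
  by_cases hxy : x = y
  · subst hxy
    simpa using hshift x 0
  · simp [hoff hxy, hxy]

end Weyl

section Intertwining

variable {d n : ℕ} [NeZero d] {U U' : Op d n} {v v' w w' u : Phase d n} {c c' : ℂ}

/-- Conjugation by `U` sends the Weyl operator of `v` to a multiple of that of `w`. The condition
is stated without an inverse of `U`, so that it makes sense for every operator. -/
def Intertwines (U : Op d n) (v w : Phase d n) : Prop :=
  ∃ c : ℂ, U * weyl v = c • (weyl w * U)

/-- Conjugation by `U` permutes the Weyl operators, up to scalars, according to the linear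
automorphism `σ` of phase space. -/
def Implements (U : Op d n) (σ : Phase d n ≃ₗ[ZMod d] Phase d n) : Prop :=
  ∀ v, Intertwines U v (σ v)

theorem ne_zero_of_mul_weyl_eq (hU : IsUnit U) (h : U * weyl v = c • (weyl w * U)) : c ≠ 0 := by
  rintro rfl
  rw [zero_smul] at h
  exact (hU.mul (isUnit_weyl v)).ne_zero h

theorem mul_weyl_add (h : U * weyl v = c • (weyl w * U)) (h' : U * weyl v' = c' • (weyl w' * U)) :
    U * weyl (v + v') = ((stdAddChar (v.2 ⬝ᵥ v'.1))⁻¹ * (c * c' * stdAddChar (w.2 ⬝ᵥ w'.1))) •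
      (weyl (w + w') * U) := by
  rw [weyl_add, mul_smul_comm, ← mul_assoc, h, smul_mul_assoc, mul_assoc, h', mul_smul_comm,
    ← mul_assoc, weyl_mul, smul_mul_assoc]
  simp only [smul_smul, mul_assoc]

namespace Intertwines

theorem one (v : Phase d n) : Intertwines 1 v v :=
  ⟨1, by rw [one_mul, mul_one, one_smul]⟩

theorem mul (h' : Intertwines U' w u) (h : Intertwines U v w) : Intertwines (U' * U) v u := by
  obtain ⟨c, hc⟩ := h
  obtain ⟨c', hc'⟩ := h'
  refine ⟨c * c', ?_⟩
  rw [mul_assoc, hc, mul_smul_comm, ← mul_assoc, hc', smul_mul_assoc, smul_smul, mul_assoc]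

theorem smul (h : Intertwines U v w) (a : ℂ) : Intertwines (a • U) v w := by
  obtain ⟨c, hc⟩ := h
  exact ⟨c, by rw [smul_mul_assoc, hc, mul_smul_comm, smul_comm]⟩

theorem add (h : Intertwines U v w) (h' : Intertwines U v' w') :
    Intertwines U (v + v') (w + w') := by
  obtain ⟨c, hc⟩ := h
  obtain ⟨c', hc'⟩ := h'
  exact ⟨_, mul_weyl_add hc hc'⟩

theorem star (hU : U ∈ Matrix.unitaryGroup (Fin n → ZMod d) ℂ) (h : Intertwines U v w) :
    Intertwines (star U) w v := by
  obtain ⟨c, hc⟩ := h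
  have hc0 : c ≠ 0 := ne_zero_of_mul_weyl_eq (Unitary.isUnit_coe (U := ⟨U, hU⟩)) hc
  have hconj : weyl v = c • (Star.star U * weyl w * U) := by
    rw [mul_assoc, ← mul_smul_comm, ← hc, ← mul_assoc, Matrix.mem_unitaryGroup_iff'.1 hU, one_mul]
  refine ⟨c⁻¹, ?_⟩
  rw [hconj, smul_mul_assoc, mul_assoc _ U, Matrix.mem_unitaryGroup_iff.1 hU, mul_one,
    inv_smul_smul₀ hc0]

theorem unique (hU : IsUnit U) (h : Intertwines U v w) (h' : Intertwines U v w') : w = w' := by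
  obtain ⟨c, hc⟩ := h
  obtain ⟨c', hc'⟩ := h'
  have hww' : c • weyl w = c' • weyl w' := by
    rw [← hU.mul_left_inj, smul_mul_assoc, smul_mul_assoc, ← hc, ← hc']
  refine eq_of_weyl_eq_smul (c := c⁻¹ * c') ?_
  rw [mul_smul, ← hww', inv_smul_smul₀ (ne_zero_of_mul_weyl_eq hU hc)]

theorem symp_eq (hU : IsUnit U) (h : Intertwines U v w) (h' : Intertwines U v' w') :
    symp w w' = symp v v' := by
  obtain ⟨c, hc⟩ := h
  obtain ⟨c', hc'⟩ := h'
  have hmul : U * (weyl v * weyl v') = (c * c') • (weyl w * weyl w' * U) := by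
    rw [← mul_assoc, hc, smul_mul_assoc, mul_assoc, hc', mul_smul_comm, smul_smul, mul_assoc]
  have hmul' : U * (weyl v' * weyl v) = (c * c') • (weyl w' * weyl w * U) := by
    rw [← mul_assoc, hc', smul_mul_assoc, mul_assoc, hc, mul_smul_comm, smul_smul, mul_assoc,
      mul_comm c']
  have hne : (c * c') • (weyl w' * weyl w * U) ≠ 0 := by
    rw [← hmul']
    exact (hU.mul ((isUnit_weyl v').mul (isUnit_weyl v))).ne_zero
  refine ZMod.injective_stdAddChar (smul_left_injective ℂ hne ?_)
  calc stdAddChar (symp w w') • (c * c') • (weyl w' * weyl w * U)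
      = U * (weyl v * weyl v') := by rw [hmul, weyl_mul_comm w, smul_mul_assoc, smul_comm]
    _ = stdAddChar (symp v v') • (c * c') • (weyl w' * weyl w * U) := by
      rw [weyl_mul_comm v, mul_smul_comm, hmul']

end Intertwines

theorem Implements.mem_isometryGroup {σ : Phase d n ≃ₗ[ZMod d] Phase d n} (hU : IsUnit U)
    (h : Implements U σ) : σ ∈ isometryGroup symp :=
  fun v v' => (h v).symp_eq hU (h v')

theorem exists_implements (hU : IsUnit U) (h : ∀ v, ∃ w, Intertwines U v w) :
    ∃ σ, Implements U σ := by
  choose f hf using h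
  let φ : Phase d n →ₗ[ZMod d] Phase d n :=
    (AddMonoidHom.mk' f fun v w => (hf _).unique hU ((hf v).add (hf w))).toZModLinearMap d
  have hinj : Function.Injective φ := by
    refine (injective_iff_map_eq_zero φ).2 fun v hv => symp_separatingLeft v fun w => ?_
    have hv : f v = 0 := hv
    rw [← (hf v).symp_eq hU (hf w), hv, map_zero, LinearMap.zero_apply]
  exact ⟨LinearEquiv.ofBijective φ ⟨hinj, Finite.surjective_of_injective hinj⟩, hf⟩

theorem exists_eq_smul_weyl_of_intertwines_self (hU : IsUnit U)
    (h : ∀ v, Intertwines U v v) : ∃ c : ℂ, ∃ u, U = c • weyl u := by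
  choose f hf using h
  have hf_unique {v : Phase d n} {a : ℂ} (ha : U * weyl v = a • (weyl v * U)) : f v = a :=
    smul_left_injective ℂ ((isUnit_weyl v).mul hU).ne_zero ((hf v).symm.trans ha)
  let ψ : AddChar (Phase d n) ℂ :=
    { toFun := f
      map_zero_eq_one' := hf_unique (by rw [weyl_zero, mul_one, one_mul, one_smul])
      map_add_eq_mul' := fun v w => hf_unique <| by
        rw [mul_weyl_add (hf v) (hf w), mul_comm (f v * f w),
          inv_mul_cancel_left₀ (stdAddChar_ne_zero _)] }
  obtain ⟨u, hu⟩ := exists_addChar_eq_stdAddChar_pairing symp_separatingLeft ψ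
  have hcomm (v : Phase d n) : Commute (U * weyl (-u)) (weyl v) := by
    have hfu : f v = stdAddChar (symp u v) := hu v
    rw [commute_iff_eq, mul_assoc, weyl_mul_comm, mul_smul_comm, ← mul_assoc, hf, smul_mul_assoc,
      smul_smul, hfu, ← AddChar.map_add_eq_mul, map_neg, LinearMap.neg_apply, neg_add_cancel,
      AddChar.map_zero_eq_one, one_smul, mul_assoc]
  obtain ⟨c, hc⟩ := eq_smul_one_of_commute_weyl hcomm
  have hcancel : weyl (-u) * weyl u = stdAddChar ((-u).2 ⬝ᵥ u.1) • (1 : Op d n) := by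
    rw [weyl_mul, neg_add_cancel, weyl_zero]
  refine ⟨(stdAddChar ((-u).2 ⬝ᵥ u.1))⁻¹ * c, u, ?_⟩
  rw [mul_smul, ← one_mul (weyl u), ← smul_mul_assoc, ← hc, mul_assoc, hcancel, mul_smul_comm,
    mul_one, inv_smul_smul₀ (stdAddChar_ne_zero _)]

theorem exists_eq_smul_mul_weyl {C : Op d n} {σ : Phase d n ≃ₗ[ZMod d] Phase d n}
    (hU : IsUnit U) (hC : C ∈ Matrix.unitaryGroup (Fin n → ZMod d) ℂ) (hUσ : Implements U σ)
    (hCσ : Implements C σ) : ∃ c : ℂ, ∃ u, U = c • (C * weyl u) := by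
  have hC' : IsUnit (star C) := (Unitary.isUnit_coe (U := ⟨C, hC⟩)).star
  obtain ⟨c, u, hu⟩ := exists_eq_smul_weyl_of_intertwines_self (hC'.mul hU) fun v =>
    ((hCσ v).star hC).mul (hUσ v)
  refine ⟨c, u, ?_⟩
  rw [← mul_smul_comm, ← hu, ← mul_assoc, Matrix.mem_unitaryGroup_iff.1 hC, one_mul]

end Intertwining
section OneQuditGates

variable {d : ℕ}

theorem matF_apply [NeZero d] (x y : ZMod d) :
    matF d x y = ((Real.sqrt d : ℝ) : ℂ)⁻¹ * stdAddChar (x * y) := by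
  rw [matF, Matrix.of_apply, omega_pow, Nat.cast_mul, ZMod.natCast_zmod_val,
    ZMod.natCast_zmod_val, mul_comm y]

theorem matF_sq_apply [NeZero d] (x y : ZMod d) :
    (matF d ^ 2) x y = if x + y = 0 then 1 else 0 := by
  have hsqrt : ((Real.sqrt d : ℝ) : ℂ) * ((Real.sqrt d : ℝ) : ℂ) = d := by
    rw [← Complex.ofReal_mul, Real.mul_self_sqrt (Nat.cast_nonneg d), Complex.ofReal_natCast]
  have hterm (z : ZMod d) : matF d x z * matF d z y = (d : ℂ)⁻¹ * stdAddChar (z * (x + y)) := by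
    rw [matF_apply, matF_apply, mul_mul_mul_comm, ← mul_inv, hsqrt, ← AddChar.map_add_eq_mul,
      mul_comm x, ← mul_add]
  simp only [pow_two, Matrix.mul_apply, hterm, ← Finset.mul_sum,
    AddChar.sum_mulShift _ (ZMod.isPrimitive_stdAddChar d), ZMod.card]
  simp

theorem star_matF_apply [NeZero d] (x y : ZMod d) : star (matF d) x y = matF d (-x) y := by
  have hsqrt : star ((Real.sqrt d : ℝ) : ℂ) = Real.sqrt d := Complex.conj_ofReal _
  rw [Matrix.star_apply, matF_apply, matF_apply, star_mul', star_inv₀, hsqrt, star_stdAddChar,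
    mul_comm y, neg_mul]

theorem matF_mem_unitaryGroup [NeZero d] : matF d ∈ Matrix.unitaryGroup (ZMod d) ℂ := by
  rw [Matrix.mem_unitaryGroup_iff']
  ext x y
  have h : (star (matF d) * matF d) x y = (matF d ^ 2) (-x) y := by
    simp only [pow_two, Matrix.mul_apply, star_matF_apply]
  simp only [h, matF_sq_apply, Matrix.one_apply, neg_add_eq_zero]

theorem matF_sq_mul_diagonal_mul_matF_sq [NeZero d] (f : ZMod d → ℂ) :
    matF d ^ 2 * Matrix.diagonal f * matF d ^ 2 = Matrix.diagonal fun j => f (-j) := by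
  ext x y
  rw [mul_assoc, Matrix.mul_apply]
  simp only [Matrix.diagonal_mul, matF_sq_apply, add_eq_zero_iff_neg_eq, ite_mul, one_mul,
    zero_mul, Finset.sum_ite_eq, Finset.mem_univ, if_true, neg_neg]
  rw [mul_ite, mul_one, mul_zero, Matrix.diagonal_apply]

theorem matF_pow_four [NeZero d] : matF d ^ 4 = 1 := by
  have h := matF_sq_mul_diagonal_mul_matF_sq (d := d) fun _ => 1
  rwa [Matrix.diagonal_one, mul_one, ← pow_add] at h

theorem matF_mul_weylOne [NeZero d] (a b : ZMod d) :
    matF d * weylOne a b = stdAddChar (-(a * b)) • (weylOne (-b) a * matF d) := by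
  ext x y
  have h (z : ZMod d) : x = z + -b ↔ x + b = z := by rw [← sub_eq_add_neg, eq_sub_iff_add_eq]
  have hphase : stdAddChar (x * (y + a)) * stdAddChar (b * y) =
      stdAddChar (-(a * b)) * (stdAddChar (a * (x + b)) * stdAddChar ((x + b) * y)) := by
    simp only [← AddChar.map_add_eq_mul]
    ring_nf
  simp only [weylOne, Matrix.mul_apply, Matrix.of_apply, Matrix.smul_apply, mul_ite, mul_zero,
    ite_mul, zero_mul, Finset.sum_ite_eq', Finset.sum_ite_eq, Finset.mem_univ, if_true,
    smul_eq_mul, matF_apply, h]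
  linear_combination ((Real.sqrt d : ℝ) : ℂ)⁻¹ * hphase

variable [Fact d.Prime]

theorem two_ne_zero_of_odd (hd : Odd d) : (2 : ZMod d) ≠ 0 :=
  Ring.two_ne_zero (by rw [ZMod.ringChar_zmod_n]; exact hd.ne_two_of_dvd_nat dvd_rfl)

theorem matS_eq (hd : Odd d) :
    matS d = Matrix.diagonal fun j => stdAddChar (j * (j + 1) / 2) := by
  have h2 : ((2 : ℕ) : ZMod d) ≠ 0 := mod_cast two_ne_zero_of_odd hd
  rw [matS]
  congr! 2 with j
  rw [omega_pow, Nat.cast_div (Nat.even_mul_succ_self _).two_dvd h2]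
  push_cast
  rw [ZMod.natCast_zmod_val]

theorem matS_mem_unitaryGroup (hd : Odd d) : matS d ∈ Matrix.unitaryGroup (ZMod d) ℂ := by
  rw [Matrix.mem_unitaryGroup_iff', matS_eq hd, Matrix.star_eq_conjTranspose,
    Matrix.diagonal_conjTranspose, Matrix.diagonal_mul_diagonal, ← Matrix.diagonal_one]
  congr! 2 with j
  rw [Pi.star_apply, star_stdAddChar, ← AddChar.map_add_eq_mul, neg_add_cancel,
    AddChar.map_zero_eq_one]

theorem matS_mul_weylOne (hd : Odd d) (a b : ZMod d) :
    matS d * weylOne a b = stdAddChar (a * (a + 1) / 2) • (weylOne a (b + a) * matS d) := by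
  have h2 := two_ne_zero_of_odd hd
  ext x y
  simp only [matS_eq hd, Matrix.diagonal_mul, Matrix.smul_apply, Matrix.mul_diagonal, weylOne,
    Matrix.of_apply, smul_eq_mul]
  split_ifs with h
  · subst h
    simp only [← AddChar.map_add_eq_mul]
    congr 1
    field_simp
    ring
  · simp only [mul_zero, zero_mul]

theorem weylOne_zero_one_eq (hd : Odd d) :
    weylOne 0 1 = matS d * (matF d ^ 2 * matS d * matF d ^ 2) ^ (d - 1) := by
  have h2 := two_ne_zero_of_odd hd
  have hd1 : ((d - 1 : ℕ) : ZMod d) = -1 := by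
    rw [Nat.cast_pred (NeZero.pos d), ZMod.natCast_self, zero_sub]
  -- Conjugation by `F ^ 2` reverses the sign of `j`, and `j (j + 1) / 2 - (-j) (1 - j) / 2 = j`.
  rw [weylOne_zero_left, matS_eq hd, matF_sq_mul_diagonal_mul_matF_sq, Matrix.diagonal_pow,
    Matrix.diagonal_mul_diagonal]
  congr! 2 with j
  rw [Pi.pow_apply, ← AddChar.map_nsmul_eq_pow, ← AddChar.map_add_eq_mul, nsmul_eq_mul, hd1]
  congr 1
  field_simp
  ring

theorem weylOne_mem_closure (hd : Odd d) (a b : ZMod d) :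
    weylOne a b ∈ Submonoid.closure {matF d, matS d} := by
  set M := Submonoid.closure {matF d, matS d}
  have hF : matF d ∈ M := Submonoid.subset_closure (Or.inl rfl)
  have hS : matS d ∈ M := Submonoid.subset_closure (Or.inr rfl)
  have hZ (b : ZMod d) : weylOne 0 b ∈ M := by
    have hpow : weylOne 0 b = weylOne (0 : ZMod d) 1 ^ b.val := by
      rw [weylOne_zero_left_pow, ZMod.natCast_zmod_val, mul_one]
    rw [hpow, weylOne_zero_one_eq hd]
    exact pow_mem (mul_mem hS (pow_mem (mul_mem (mul_mem (pow_mem hF 2) hS) (pow_mem hF 2)) _)) _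
  have hX : weylOne a 0 ∈ M := by
    have hconj : weylOne a 0 = matF d * weylOne 0 (-a) * matF d ^ 3 := by
      rw [matF_mul_weylOne, smul_mul_assoc, mul_assoc, ← pow_succ', matF_pow_four]
      simp
    rw [hconj]
    exact mul_mem (mul_mem hF (hZ _)) (pow_mem hF 3)
  have hXZ : weylOne a b = weylOne a 0 * weylOne 0 b := by rw [weylOne_mul]; simp
  rw [hXZ]
  exact mul_mem hX (hZ b)

end OneQuditGates

section Circuits

variable {d n : ℕ} {E : Fin n → Fin n → Prop}

theorem tensor_mem_circuits [NeZero d] {p : Fin n → Op1 d}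
    (hp : ∀ i, p i ∈ Submonoid.closure {matF d, matS d}) : tensor p ∈ circuits d n E := by
  refine Submonoid.pi_mem_of_mulSingle_mem (H := (circuits d n E).comap tensorHom) p fun i => ?_
  have hle : Submonoid.closure {matF d, matS d} ≤
      (circuits d n E).comap (tensorHom.comp (MonoidHom.mulSingle _ i)) := by
    refine Submonoid.closure_le.2 ?_
    rintro _ (rfl | rfl)
    · exact Submonoid.subset_closure (Or.inl ⟨i, rfl⟩)
    · exact Submonoid.subset_closure (Or.inr (Or.inl ⟨i, rfl⟩))
  exact hle (hp i)

theorem weyl_mem_circuits [Fact d.Prime] (hd : Odd d) (v : Phase d n) :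
    weyl v ∈ circuits d n E :=
  tensor_mem_circuits fun _ => weylOne_mem_closure hd _ _

end Circuits

section GateActions

variable {d n : ℕ}

theorem onPair_matCX_apply {i j : Fin n} (hij : i ≠ j) (x y : Fin n → ZMod d) :
    onPair i j (matCX d) x y = if x = y + Pi.single j (y i) then 1 else 0 := by
  have h : x = y + Pi.single j (y i) ↔
      (∀ k, k ≠ i → k ≠ j → x k = y k) ∧ (x i, x j) = (y i, y i + y j) := by
    rw [Prod.mk.injEq]
    refine ⟨?_, fun ⟨hk, hi, hj⟩ => funext fun k => ?_⟩
    · rintro rfl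
      exact ⟨fun k _ hk => by simp [hk], by simp [hij], by simp [add_comm]⟩
    · obtain rfl | hkj := eq_or_ne k j
      · simp [hj, add_comm]
      obtain rfl | hki := eq_or_ne k i
      · simp [hi, hkj]
      · simp [hk k hki hkj, hkj]
  simp only [onPair, Matrix.of_apply, matCX, h, ite_and]

theorem onPair_matCX_mem_unitaryGroup [NeZero d] {i j : Fin n} (hij : i ≠ j) :
    onPair i j (matCX d) ∈ Matrix.unitaryGroup (Fin n → ZMod d) ℂ := by
  rw [Matrix.mem_unitaryGroup_iff']
  ext x y
  have h : y + Pi.single j (y i) = x + Pi.single j (x i) ↔ x = y := by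
    refine ⟨fun h => ?_, fun h => by rw [h]⟩
    have hi : y i = x i := by simpa [hij] using congrFun h i
    rw [hi] at h
    exact (add_right_cancel h).symm
  simp only [Matrix.mul_apply, Matrix.star_apply, onPair_matCX_apply hij, apply_ite star, star_one,
    star_zero, mul_ite, mul_one, mul_zero, Finset.sum_ite_eq', Finset.mem_univ, if_true,
    Matrix.one_apply, h]

theorem intertwines_onPair_matCX [NeZero d] {i j : Fin n} (hij : i ≠ j) (v : Phase d n) :
    Intertwines (onPair i j (matCX d)) v
      (v.1 + Pi.single j (v.1 i), v.2 - Pi.single i (v.2 j)) := by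
  refine ⟨1, ?_⟩
  ext x y
  have hadd : y + v.1 + Pi.single j ((y + v.1) i) =
      y + Pi.single j (y i) + (v.1 + Pi.single j (v.1 i)) := by
    rw [Pi.add_apply, Pi.single_add]
    abel
  have hdot : (v.2 - Pi.single i (v.2 j)) ⬝ᵥ (y + Pi.single j (y i)) = v.2 ⬝ᵥ y := by
    simp [sub_dotProduct, dotProduct_add, hij]
  simp only [Matrix.mul_apply, one_smul, onPair_matCX_apply hij, weyl_apply, mul_ite, mul_zero,
    mul_one, Finset.sum_ite_eq', Finset.mem_univ, if_true, hdot, ← hadd, ite_mul, one_mul,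
    zero_mul]

theorem intertwines_onQudit [NeZero d] (i : Fin n) {g : Op1 d} {v : Phase d n} {a b : ZMod d}
    {c : ℂ} (h : g * weylOne (v.1 i) (v.2 i) = c • (weylOne a b * g)) :
    Intertwines (onQudit i g) v (Function.update v.1 i a, Function.update v.2 i b) := by
  refine ⟨∏ k, Function.update (fun _ : Fin n => (1 : ℂ)) i c k, ?_⟩
  simp only [onQudit_eq_tensorHom, weyl, ← tensorHom_apply, ← map_mul]
  rw [tensorHom_apply, tensorHom_apply, ← tensor_smul]
  congr 1
  funext k
  obtain rfl | hk := eq_or_ne k i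
  · simpa using h
  · simp [hk]

theorem intertwines_onQudit_matF [NeZero d] (i : Fin n) (v : Phase d n) :
    Intertwines (onQudit i (matF d)) v
      (Function.update v.1 i (-v.2 i), Function.update v.2 i (v.1 i)) :=
  intertwines_onQudit i (matF_mul_weylOne _ _)

theorem implements_onQudit_matS [Fact d.Prime] (hd : Odd d) (i : Fin n) :
    Implements (onQudit i (matS d)) (transvection symp_isAlt (zVec i) 1) := by
  intro v
  have h := intertwines_onQudit i (matS_mul_weylOne hd (v.1 i) (v.2 i))
  rw [Function.update_eq_self] at h
  convert h using 1
  ext k <;> obtain rfl | hk := eq_or_ne k i <;>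
    simp [transvection_apply, symp_apply, zVec, *]

end GateActions
section Clifford

variable {d n : ℕ} [NeZero d]

theorem matX_eq : matX d = weylOne 1 0 := by
  ext x y
  simp [matX, weylOne]

theorem matZ_eq : matZ d = weylOne 0 1 := by
  simp only [matZ, weylOne_zero_left, omega_pow, ZMod.natCast_zmod_val, one_mul]

theorem exists_eq_smul_weylOne {p : Matrix.unitaryGroup (ZMod d) ℂ} (hp : p ∈ pauliOne d) :
    ∃ (c : ℂ) (a b : ZMod d), (p : Op1 d) = c • weylOne a b := by
  induction hp using Subgroup.closure_induction with
  | mem p hp =>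
    rcases hp with rfl | rfl
    · exact ⟨1, 1, 0, by rw [one_smul, ← matX_eq]⟩
    · exact ⟨1, 0, 1, by rw [one_smul, ← matZ_eq]⟩
  | one => exact ⟨1, 0, 0, by rw [weylOne_zero, one_smul]; rfl⟩
  | mul p q _ _ hp hq =>
    obtain ⟨c, a, b, h⟩ := hp
    obtain ⟨c', a', b', h'⟩ := hq
    refine ⟨c * c' * stdAddChar (b * a'), a + a', b + b', ?_⟩
    rw [Submonoid.coe_mul, h, h', smul_mul_smul_comm, weylOne_mul, smul_smul]
  | inv p _ hp =>
    obtain ⟨c, a, b, h⟩ := hp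
    refine ⟨star c * stdAddChar (a * b), -a, -b, ?_⟩
    change star (p : Op1 d) = _
    rw [h, star_smul, star_weylOne, smul_smul]

theorem weylOne_mem_pauliOne (a b : ZMod d) :
    (⟨weylOne a b, weylOne_mem_unitaryGroup a b⟩ : Matrix.unitaryGroup (ZMod d) ℂ) ∈
      pauliOne d := by
  have h : (⟨weylOne a b, weylOne_mem_unitaryGroup a b⟩ : Matrix.unitaryGroup (ZMod d) ℂ) =
      ⟨matX d, matX_mem d⟩ ^ a.val * ⟨matZ d, matZ_mem d⟩ ^ b.val := by
    refine Subtype.ext ?_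
    simp only [Submonoid.coe_mul, SubmonoidClass.coe_pow, matX_eq, matZ_eq]
    rw [weylOne_zero_left_pow, weylOne_zero_right_pow, weylOne_mul]
    simp
  have hX : ⟨matX d, matX_mem d⟩ ∈ pauliOne d := Subgroup.subset_closure (Or.inl rfl)
  have hZ : ⟨matZ d, matZ_mem d⟩ ∈ pauliOne d := Subgroup.subset_closure (Or.inr rfl)
  exact h ▸ mul_mem (pow_mem hX _) (pow_mem hZ _)

theorem weyl_mem_pauli (v : Phase d n) : weyl v ∈ pauli d n :=
  ⟨fun k => ⟨weylOne (v.1 k) (v.2 k), weylOne_mem_unitaryGroup _ _⟩,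
    fun _ => weylOne_mem_pauliOne _ _, rfl⟩

theorem exists_eq_smul_weyl {A : Op d n} (hA : A ∈ pauli d n) :
    ∃ (c : ℂ) (v : Phase d n), A = c • weyl v := by
  obtain ⟨p, hp, rfl⟩ := hA
  choose c a b h using fun k => exists_eq_smul_weylOne (hp k)
  refine ⟨∏ k, c k, (a, b), ?_⟩
  simp only [h, tensor_smul, weyl]

theorem mem_clifford_iff {U : Op d n} :
    U ∈ clifford d n ↔
      U ∈ Matrix.unitaryGroup (Fin n → ZMod d) ℂ ∧ ∀ v, ∃ w, Intertwines U v w := by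
  refine and_congr_right fun hU => ⟨fun h v => ?_, fun h A hA => ?_⟩
  · obtain ⟨A', hA', c, hc⟩ := h _ (weyl_mem_pauli v)
    obtain ⟨c', w, rfl⟩ := exists_eq_smul_weyl hA'
    refine ⟨w, c * c', ?_⟩
    rw [← smul_mul_assoc, ← smul_smul, ← hc, mul_assoc, ← Matrix.star_eq_conjTranspose,
      Matrix.mem_unitaryGroup_iff'.1 hU, mul_one]
  · obtain ⟨c, v, rfl⟩ := exists_eq_smul_weyl hA
    obtain ⟨w, c', hw⟩ := h v
    refine ⟨weyl w, weyl_mem_pauli w, c * c', ?_⟩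
    rw [mul_smul_comm, hw, smul_mul_assoc, smul_mul_assoc, mul_assoc,
      ← Matrix.star_eq_conjTranspose, Matrix.mem_unitaryGroup_iff.1 hU, mul_one, smul_smul]

theorem smul_mem_unitaryGroup_iff {ι : Type*} [Fintype ι] [DecidableEq ι] [Nonempty ι]
    {U : Matrix ι ι ℂ} (hU : U ∈ Matrix.unitaryGroup ι ℂ) {c : ℂ} :
    c • U ∈ Matrix.unitaryGroup ι ℂ ↔ ‖c‖ = 1 := by
  have hone : (star c * c) • (1 : Matrix ι ι ℂ) = 1 ↔ star c * c = 1 :=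
    ⟨fun h => smul_left_injective ℂ one_ne_zero (h.trans (one_smul ℂ _).symm),
      fun h => by rw [h, one_smul]⟩
  rw [Matrix.mem_unitaryGroup_iff', star_smul, smul_mul_smul_comm,
    Matrix.mem_unitaryGroup_iff'.1 hU, hone, Complex.star_def, Complex.conj_mul']
  norm_cast
  exact pow_eq_one_iff_of_nonneg (norm_nonneg c) two_ne_zero

theorem mul_mem_clifford {U U' : Op d n} (hU : U ∈ clifford d n) (hU' : U' ∈ clifford d n) :
    U * U' ∈ clifford d n := by
  rw [mem_clifford_iff] at *
  refine ⟨mul_mem hU.1 hU'.1, fun v => ?_⟩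
  obtain ⟨w, hw⟩ := hU'.2 v
  obtain ⟨u, hu⟩ := hU.2 w
  exact ⟨u, hu.mul hw⟩

end Clifford

section CircuitsAreClifford

variable {d n : ℕ} [Fact d.Prime] {E : Fin n → Fin n → Prop}

theorem gates_subset_clifford (hd : Odd d) : gates d n E ⊆ clifford d n := by
  rintro _ (⟨i, rfl⟩ | ⟨i, rfl⟩ | ⟨i, j, hij, -, rfl⟩) <;> refine mem_clifford_iff.2 ⟨?_, ?_⟩
  · exact onQudit_mem_unitaryGroup i matF_mem_unitaryGroup
  · exact fun v => ⟨_, intertwines_onQudit_matF i v⟩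
  · exact onQudit_mem_unitaryGroup i (matS_mem_unitaryGroup hd)
  · exact fun v => ⟨_, implements_onQudit_matS hd i v⟩
  · exact onPair_matCX_mem_unitaryGroup hij
  · exact fun v => ⟨_, intertwines_onPair_matCX hij v⟩

theorem circuits_subset_clifford (hd : Odd d) :
    (circuits d n E : Set (Op d n)) ⊆ clifford d n := fun U hU => by
  induction hU using Submonoid.closure_induction with
  | mem U hU => exact gates_subset_clifford hd hU
  | one => exact mem_clifford_iff.2 ⟨one_mem _, fun v => ⟨v, Intertwines.one v⟩⟩
  | mul U U' _ _ h h' => exact mul_mem_clifford h h'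

theorem circuitsUpToPhase_subset_clifford (hd : Odd d) :
    circuitsUpToPhase d n E ⊆ clifford d n := by
  rintro _ ⟨c, hc, C, hC, rfl⟩
  obtain ⟨hCu, h⟩ := mem_clifford_iff.1 (circuits_subset_clifford hd hC)
  refine mem_clifford_iff.2 ⟨(smul_mem_unitaryGroup_iff hCu).2 hc, fun v => ?_⟩
  exact (h v).imp fun w hw => hw.smul c

end CircuitsAreClifford

section CircuitActions

variable {d n : ℕ}

/-- The group of automorphisms of phase space generated by the actions of the gates. -/
def circuitActions (d n : ℕ) [NeZero d] (E : Fin n → Fin n → Prop) :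
    Subgroup (Phase d n ≃ₗ[ZMod d] Phase d n) :=
  Subgroup.closure {σ | ∃ U ∈ gates d n E, Implements U σ}

variable {E : Fin n → Fin n → Prop}

theorem mem_circuitActions [NeZero d] {U : Op d n} {σ : Phase d n ≃ₗ[ZMod d] Phase d n}
    (hU : U ∈ gates d n E) (hσ : Implements U σ) : σ ∈ circuitActions d n E :=
  Subgroup.subset_closure ⟨U, hU, hσ⟩

theorem exists_mem_circuits_implements [NeZero d] {σ : Phase d n ≃ₗ[ZMod d] Phase d n}
    (hσ : σ ∈ circuitActions d n E) : ∃ C ∈ circuits d n E, Implements C σ := by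
  -- Phase space is finite, so inverses of actions are positive powers.
  have : Finite (Phase d n ≃ₗ[ZMod d] Phase d n) :=
    Finite.of_injective _ DFunLike.coe_injective
  rw [circuitActions, ← Subgroup.mem_toSubmonoid,
    Subgroup.closure_toSubmonoid_of_isOfFinOrder fun σ _ => isOfFinOrder_of_finite σ] at hσ
  induction hσ using Submonoid.closure_induction with
  | mem σ hσ =>
    obtain ⟨U, hU, hUσ⟩ := hσ
    exact ⟨U, Submonoid.subset_closure hU, hUσ⟩
  | one => exact ⟨1, one_mem _, Intertwines.one⟩
  | mul σ τ _ _ hσ hτ =>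
    obtain ⟨C, hC, hCσ⟩ := hσ
    obtain ⟨C', hC', hCτ⟩ := hτ
    exact ⟨C * C', mul_mem hC hC', fun v => (hCσ (τ v)).mul (hCτ v)⟩

variable [Fact d.Prime]

theorem mem_transvectionDirections_of_intertwines (hd : Odd d) {U : Op d n}
    (hU : U ∈ gates d n E) {v w : Phase d n} (hvw : Intertwines U v w)
    (hv : v ∈ transvectionDirections symp_isAlt (circuitActions d n E)) :
    w ∈ transvectionDirections symp_isAlt (circuitActions d n E) := by
  obtain ⟨hUu, h⟩ := mem_clifford_iff.1 (gates_subset_clifford hd hU)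
  have hU1 : IsUnit U := Unitary.isUnit_coe (U := ⟨U, hUu⟩)
  obtain ⟨σ, hσ⟩ := exists_implements hU1 h
  rw [hvw.unique hU1 (hσ v)]
  exact map_mem_transvectionDirections (mem_circuitActions hU hσ)
    (hσ.mem_isometryGroup hU1) hv

theorem zVec_mem_transvectionDirections (hd : Odd d) (i : Fin n) :
    zVec i ∈ transvectionDirections symp_isAlt (circuitActions d n E) := fun t => by
  have ht : t = t.val • (1 : ZMod d) := by rw [nsmul_one, ZMod.natCast_zmod_val]
  rw [ht, transvection_nsmul]
  exact pow_mem (mem_circuitActions (Or.inr (Or.inl ⟨i, rfl⟩)) (implements_onQudit_matS hd i)) _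

theorem xVec_mem_transvectionDirections (hd : Odd d) (i : Fin n) :
    xVec i ∈ transvectionDirections symp_isAlt (circuitActions d n E) := by
  have hF : Intertwines (onQudit i (matF d)) (zVec i) (-xVec i) := by
    convert intertwines_onQudit_matF (d := d) i (zVec i) using 1
    ext k <;> obtain rfl | hk := eq_or_ne k i <;> simp [xVec, zVec, *]
  rw [← neg_neg (xVec i), ← neg_one_smul (ZMod d)]
  exact (hyperbolicClosed_transvectionDirections symp_isAlt _).smul_mem _ <|
    mem_transvectionDirections_of_intertwines hd (Or.inl ⟨i, rfl⟩) hF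
      (zVec_mem_transvectionDirections hd i)

theorem xVec_add_xVec_mem_transvectionDirections (hd : Odd d) {i j : Fin n} (hij : i ≠ j)
    (hE : E i j) :
    xVec i + xVec j ∈ transvectionDirections symp_isAlt (circuitActions d n E) := by
  have hCX : Intertwines (onPair i j (matCX d)) (xVec i) (xVec i + xVec j) := by
    convert intertwines_onPair_matCX (d := d) hij (xVec i) using 1
    ext k <;> simp [xVec]
  exact mem_transvectionDirections_of_intertwines hd (Or.inr (Or.inr ⟨i, j, hij, hE, rfl⟩)) hCX
    (xVec_mem_transvectionDirections hd i)

theorem nonorthogonallyConnected_xVec_zVec (hd : Odd d)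
    (hE : (SimpleGraph.fromRel E).Preconnected) :
    NonorthogonallyConnected (symp : LinearMap.BilinForm (ZMod d) (Phase d n))
      (Set.range xVec ∪ Set.range zVec)
      (transvectionDirections symp_isAlt (circuitActions d n E)) := by
  set T := transvectionDirections symp_isAlt (circuitActions d n E)
  set r : Phase d n → Phase d n → Prop := fun u v => u ∈ T ∧ v ∈ T ∧ symp u v ≠ 0
  have : Std.Symm r := ⟨fun u v h => ⟨h.2.1, h.1, ne_zero_comm symp_isAlt h.2.2⟩⟩
  have hx (i : Fin n) : xVec i ∈ T := xVec_mem_transvectionDirections hd i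
  have hz (i : Fin n) : zVec i ∈ T := zVec_mem_transvectionDirections hd i
  have hadj (i j : Fin n) (h : (SimpleGraph.fromRel E).Adj i j) :
      Relation.ReflTransGen r (zVec i) (zVec j) := by
    obtain ⟨hij, h⟩ := (SimpleGraph.fromRel_adj E i j).1 h
    have hsum : xVec i + xVec j ∈ T := by
      rcases h with h | h
      · exact xVec_add_xVec_mem_transvectionDirections hd hij h
      · rw [add_comm]
        exact xVec_add_xVec_mem_transvectionDirections hd hij.symm h
    refine .tail (.single ⟨hz i, hsum, ?_⟩) ⟨hsum, hz j, ?_⟩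
    · simp [symp_xVec, zVec, hij.symm]
    · simp [symp_zVec, xVec, hij.symm]
  have hzz (i j : Fin n) : Relation.ReflTransGen r (zVec i) (zVec j) :=
    Relation.ReflTransGen.lift' zVec hadj i j
      ((SimpleGraph.reachable_iff_reflTransGen i j).1 (hE i j))
  have hsz (s : Phase d n) (hs : s ∈ Set.range xVec ∪ Set.range zVec) :
      ∃ i, Relation.ReflTransGen r s (zVec i) := by
    rcases hs with ⟨i, rfl⟩ | ⟨i, rfl⟩
    · exact ⟨i, .single ⟨hx i, hz i, by simp [symp_zVec, xVec]⟩⟩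
    · exact ⟨i, .refl⟩
  intro s hs s' hs'
  obtain ⟨i, hi⟩ := hsz s hs
  obtain ⟨j, hj⟩ := hsz s' hs'
  exact (hi.trans (hzz i j)).trans (symm hj)

theorem isometryGroup_symp_le_circuitActions (hd : Odd d)
    (hE : (SimpleGraph.fromRel E).Preconnected) :
    isometryGroup symp ≤ circuitActions d n E := by
  have hK : 3 ≤ Cardinal.mk (ZMod d) := by
    have hd2 : d ≠ 2 := by
      rintro rfl
      exact absurd hd (by decide)
    rw [Cardinal.mk_fintype, ZMod.card]
    exact_mod_cast (Fact.out : d.Prime).two_le.lt_of_ne' hd2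
  refine isometryGroup_le_of_nonorthogonallyConnected symp_isAlt symp_separatingLeft hK
    span_range_xVec_union_range_zVec ?_ (nonorthogonallyConnected_xVec_zVec hd hE)
  rintro _ (⟨i, rfl⟩ | ⟨i, rfl⟩)
  · exact xVec_mem_transvectionDirections hd i
  · exact zVec_mem_transvectionDirections hd i

theorem clifford_subset_circuitsUpToPhase (hd : Odd d)
    (hE : (SimpleGraph.fromRel E).Preconnected) :
    clifford d n ⊆ circuitsUpToPhase d n E := fun U hU => by
  obtain ⟨hUu, h⟩ := mem_clifford_iff.1 hU
  have hU1 : IsUnit U := Unitary.isUnit_coe (U := ⟨U, hUu⟩)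
  obtain ⟨σ, hσ⟩ := exists_implements hU1 h
  obtain ⟨C, hC, hCσ⟩ := exists_mem_circuits_implements
    (isometryGroup_symp_le_circuitActions hd hE (hσ.mem_isometryGroup hU1))
  have hCu := (mem_clifford_iff.1 (circuits_subset_clifford hd hC)).1
  obtain ⟨c, u, rfl⟩ := exists_eq_smul_mul_weyl hU1 hCu hσ hCσ
  exact ⟨c, (smul_mem_unitaryGroup_iff (mul_mem hCu (weyl_mem_unitaryGroup u))).1 hUu,
    C * weyl u, mul_mem hC (weyl_mem_circuits hd u), rfl⟩

end CircuitActions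

end Qudit

theorem mainTheorem1_general (d n : ℕ) [Fact d.Prime] (hd : Odd d) (E : Fin n → Fin n → Prop)
    (hE : (SimpleGraph.fromRel E).Preconnected) :
    Qudit.clifford d n = Qudit.circuitsUpToPhase d n E :=
  (Qudit.clifford_subset_circuitsUpToPhase hd hE).antisymm
    (Qudit.circuitsUpToPhase_subset_clifford hd)

/-- For `d` an odd prime, the `n`-qudit Clifford group is exactly the set of operators that are,
up to a global phase, circuits over `{C_X, F, S}`. This holds both when `C_X` may be applied to
any ordered pair of distinct qudits, and when it may only be applied to neighbouring qudits,
with control `i` and target `i + 1`. -/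
theorem mainTheorem1 (d n : ℕ) [Fact d.Prime] (hd : Odd d) :
    Qudit.clifford d n = Qudit.circuitsUpToPhase d n (fun _ _ => True) ∧
    Qudit.clifford d n = Qudit.circuitsUpToPhase d n (fun i j => i.val + 1 = j.val) := by
  have hpath : SimpleGraph.pathGraph n ≤ SimpleGraph.fromRel fun i j => i.val + 1 = j.val := by
    intro i j hij
    exact (SimpleGraph.fromRel_adj _ i j).2 ⟨hij.ne, SimpleGraph.pathGraph_adj.1 hij⟩
  have htop : SimpleGraph.pathGraph n ≤ SimpleGraph.fromRel fun _ _ => True := fun i j hij =>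
    (SimpleGraph.fromRel_adj _ i j).2 ⟨hij.ne, Or.inl trivial⟩
  exact ⟨mainTheorem1_general d n hd _ ((SimpleGraph.pathGraph_preconnected n).mono htop),
    mainTheorem1_general d n hd _ ((SimpleGraph.pathGraph_preconnected n).mono hpath)⟩
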